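/- Let $S$ be a (discrete) semigroup that is cancellative (all left and all right translations are injective), finitely generated as a semigroup, and finitely left divisible, meaning that for every $s\in S$ the set $\{t\in S : \exists\, r\in S,\ tr=s\}$ is finite. Consider complex scalars, regard $\ell^1(S)$ as a Banach algebra with convolution ($\delta_s*\delta_t=\delta_{st}$), and $\ell^\infty(S)=\ell^1(S)^*$ as an $\ell^1(S)$-bimodule via $\langle a\cdot\mu,b\rangle=\langle\mu,b*a\rangle$ and $\langle\mu\cdot a,b\rangle=\langle\mu,a*b\rangle$. A Hopf algebra predual of $\ell^1(S)$ is a closed sub-bimodule $E\subseteq\ell^\infty(S)$ which is closed under the pointwise product and for which the canonical map $\ell^1(S)\to E^*$, $a\mapsto(\mu\mapsto\sum_{s\in S}a_s\mu(s))$, is an isomorphism of Banach spaces (not necessarily isometric). Then: (a) every Hopf algebra predual $E\subseteq\ell^\infty(S)$ of $\ell^1(S)$ equals $c_0(S)$; (b) (the equivalent topological form) every locally compact Hausdorff topology $\sigma$ on $S$ such that (i) the product of $S$ is separately $\sigma$-continuous, and (ii) whenever $s\in S$ and $(t_n)$ is a sequence in $S$ for which $(t_ns)$ converges or $(st_n)$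 converges, the sequence $(t_n)$ converges, is the discrete topology. -/

import Mathlib

open Filter Topology
open scoped ENNReal

noncomputable section

namespace HopfPredual

/-- The Banach space `ℓ¹(S)` of absolutely summable complex families on `S`. -/
abbrev Ell1 (S : Type*) := lp (fun _ : S => ℂ) 1

/-- The Banach algebra `ℓ^∞(S)` of bounded complex families on `S`, with pointwise product. -/
abbrev EllInf (S : Type*) := lp (fun _ : S => ℂ) ∞

/-- The dual pairing `⟨μ, a⟩ = ∑ₛ aₛ μ(s)` between `ℓ^∞(S) = ℓ¹(S)*` and `ℓ¹(S)`. -/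
def pairing {S : Type*} (μ : EllInf S) (a : Ell1 S) : ℂ :=
  ∑' s, a s * μ s

/-- The convolution of two elements of `ℓ¹(S)` is absolutely summable. -/
theorem memℓp_conv {S : Type*} [Semigroup S] (a b : Ell1 S) :
    Memℓp (fun u : S => ∑' p : {p : S × S // p.1 * p.2 = u}, a p.1.1 * b p.1.2) 1 := by
  have ha : Summable fun s => ‖a s‖ := by
    simpa using (lp.memℓp a).summable (by norm_num)
  have hb : Summable fun s => ‖b s‖ := by
    simpa using (lp.memℓp b).summable (by norm_num)
  have hab : Summable fun p : S × S => ‖a p.1 * b p.2‖ := by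
    simpa using ha.mul_of_nonneg hb (fun _ => norm_nonneg _) (fun _ => norm_nonneg _)
  have hs := (Equiv.sigmaFiberEquiv fun p : S × S => p.1 * p.2).summable_iff.mpr hab
  refine memℓp_gen ?_
  simp only [ENNReal.toReal_one, Real.rpow_one]
  exact Summable.of_nonneg_of_le (fun _ => norm_nonneg _)
    (fun u => norm_tsum_le_tsum_norm (hs.sigma_factor u)) hs.sigma

/-- The convolution product of `ℓ¹(S)`, the continuous bilinear extension of `δₛ * δₜ = δₛₜ`:
`(a * b)(u) = ∑_{st = u} a(s) b(t)`. -/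
def conv {S : Type*} [Semigroup S] (a b : Ell1 S) : Ell1 S :=
  ⟨fun u => ∑' p : {p : S × S // p.1 * p.2 = u}, a p.1.1 * b p.1.2, memℓp_conv a b⟩

/-- `E ⊆ ℓ^∞(S)` is a sub-bimodule for the dual actions of `ℓ¹(S)`, that is, for every `μ ∈ E` and
`a ∈ ℓ¹(S)` the functionals `a · μ` and `μ · a`, given by `⟨a · μ, b⟩ = ⟨μ, b * a⟩` and
`⟨μ · a, b⟩ = ⟨μ, a * b⟩`, belong to `E`. -/
def IsSubBimodule {S : Type*} [Semigroup S] (E : Submodule ℂ (EllInf S)) : Prop :=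
  ∀ a : Ell1 S, ∀ μ ∈ E,
    (∃ ν ∈ E, ∀ b : Ell1 S, pairing ν b = pairing μ (conv b a)) ∧
    (∃ ν ∈ E, ∀ b : Ell1 S, pairing ν b = pairing μ (conv a b))

/-- The canonical map `ℓ¹(S) → E*`, `a ↦ (μ ↦ ⟨μ, a⟩)`, is an isomorphism of Banach spaces
(not necessarily isometric). -/
def IsBanachSpacePredual {S : Type*} (E : Submodule ℂ (EllInf S)) : Prop :=
  ∃ Φ : Ell1 S ≃L[ℂ] (E →L[ℂ] ℂ), ∀ (a : Ell1 S) (μ : E), Φ a μ = pairing (μ : EllInf S) a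

/-- A Hopf algebra predual of `ℓ¹(S)`: a closed sub-bimodule of `ℓ^∞(S)` that is a Banach space
predual of `ℓ¹(S)` and is closed under the pointwise product. -/
structure IsHopfAlgebraPredual {S : Type*} [Semigroup S] (E : Submodule ℂ (EllInf S)) : Prop where
  isClosed : IsClosed (E : Set (EllInf S))
  isSubBimodule : IsSubBimodule E
  isBanachSpacePredual : IsBanachSpacePredual E
  mul_mem : ∀ μ ∈ E, ∀ ν ∈ E, μ * ν ∈ E

/-- `c₀(S)` inside `ℓ^∞(S)`. -/
def c0 (S : Type*) : Submodule ℂ (EllInf S) where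
  carrier := {μ | Tendsto (fun s => μ s) cofinite (𝓝 0)}
  add_mem' := fun {μ ν} hμ hν => by simpa using Tendsto.add hμ hν
  zero_mem' := by simpa using (tendsto_const_nhds : Tendsto (fun _ : S => (0 : ℂ)) cofinite (𝓝 0))
  smul_mem' := fun c μ hμ => by simpa using Tendsto.const_mul c hμ

/-- Every element has only finitely many left divisors. -/
def FinitelyLeftDivisible (S : Type*) [Semigroup S] : Prop :=
  ∀ s : S, {t : S | ∃ r : S, t * r = s}.Finite

/-- `S` is generated as a semigroup by a finite subset. -/
def FinitelyGenerated (S : Type*) [Semigroup S] : Prop :=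
  ∃ C : Set S, C.Finite ∧ Subsemigroup.closure C = ⊤

/-- The product of `S` is separately continuous. -/
def IsSemitopological (S : Type*) [Semigroup S] [TopologicalSpace S] : Prop :=
  ∀ s : S, Continuous (fun t => s * t) ∧ Continuous (fun t => t * s)

/-- The sequence `u` converges to some point. -/
def Converges {S : Type*} [TopologicalSpace S] (u : ℕ → S) : Prop :=
  ∃ x : S, Tendsto u atTop (𝓝 x)

/-- If a left or right translate of a sequence converges, then so does the sequence. -/
def TranslatesReflectConvergence (S : Type*) [Semigroup S] [TopologicalSpace S] : Prop :=
  ∀ (s : S) (t : ℕ → S),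
    (Converges (fun n => t n * s) ∨ Converges (fun n => s * t n)) → Converges t

end HopfPredual

end

/-!
# Uniqueness of the Hopf algebra predual of `ℓ¹(S)`

The statement about topologies implies the one about preduals, and rests on word length. A finitely
generated semigroup is countable, and a countable locally compact Hausdorff space is first
countable, so in a non-discrete topology some convergent sequence takes each value only finitely
often. Almost all terms of such a sequence end in one of finitely many
generators, and the reflection of convergence allows one to delete a common last generator along a
subsequence (`exists_tendsto_prefix`). Iterating gives a chain of convergent sequences whose limits
are left divisors of the original limit. There are only finitely many of those, so two of the limits
agree. By cancellation the word deleted between them acts as a right identity, which is impossible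
when the deletions shorten the words (`discreteTopology_of_translatesReflectConvergence`).

For preduals, give `S` the weak topology of the predual `E`. Since `E* = ℓ¹(S)`, a limit of point
evaluations on `E` along an ultrafilter is given by an element `a` of `ℓ¹(S)`; it is multiplicative
because `E` is an algebra, and therefore is either zero or the evaluation at a point
(`tendsto_apply_or_tendsto_zero`). So `S` together with `0` is compact, and `S` is locally compact
Hausdorff. Translations are continuous and fix `0`, because `E` is a bimodule, and they are
injective, so they reflect convergence (`converges_of_converges_comp`). So the topology is
discrete. Elements of `E` vanish at infinity for it, that is, `E ⊆ c₀(S)`, and the Hahn–Banach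
theorem gives equality because `E` separates the points of `ℓ¹(S) = c₀(S)*`
(`IsBanachSpacePredual.eq_c0`).
-/

namespace HopfPredual

/-! ### Words in a finitely generated semigroup -/

section Words

variable {S : Type*} [Semigroup S]

/-- The set of products of exactly `n + 1` elements of `C`. -/
def words (C : Set S) : ℕ → Set S
  | 0 => C
  | n + 1 => Set.image2 (· * ·) (words C n) C

theorem finite_words {C : Set S} (hC : C.Finite) (n : ℕ) : (words C n).Finite := by
  induction n with
  | zero => exact hC
  | succ n ih => exact ih.image2 _ hC

theorem mul_mem_words {C : Set S} {s t : S} {m n : ℕ} (hs : s ∈ words C m) (ht : t ∈ words C n) :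
    s * t ∈ words C (m + n + 1) := by
  induction n generalizing t with
  | zero => exact ⟨s, hs, t, ht, rfl⟩
  | succ n ih =>
    obtain ⟨r, hr, c, hc, rfl⟩ := ht
    exact ⟨s * r, ih hr, c, hc, mul_assoc s r c⟩

theorem exists_mem_words {C : Set S} (hC : Subsemigroup.closure C = ⊤) (s : S) :
    ∃ n, s ∈ words C n := by
  have hs : s ∈ Subsemigroup.closure C := hC ▸ Subsemigroup.mem_top s
  induction hs using Subsemigroup.closure_induction with
  | mem x hx => exact ⟨0, hx⟩
  | mul x y _ _ hx hy =>
    obtain ⟨m, hm⟩ := hx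
    obtain ⟨n, hn⟩ := hy
    exact ⟨_, mul_mem_words hm hn⟩

theorem FinitelyGenerated.countable (h : FinitelyGenerated S) : Countable S := by
  obtain ⟨C, hC, hgen⟩ := h
  have huniv : (⋃ n, words C n) = Set.univ :=
    Set.eq_univ_of_forall fun s => Set.mem_iUnion.mpr (exists_mem_words hgen s)
  rw [← Set.countable_univ_iff, ← huniv]
  exact Set.countable_iUnion fun n => (finite_words hC n).countable

/-- Word length: every element that is not a generator is a shorter element times a generator. -/
theorem exists_length {C : Set S} (hgen : Subsemigroup.closure C = ⊤) :
    ∃ ℓ : S → ℕ, ∀ s ∉ C, ∃ t, ∃ c ∈ C, t * c = s ∧ ℓ t < ℓ s := by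
  classical
  refine ⟨fun s => Nat.find (exists_mem_words hgen s), fun s hs => ?_⟩
  have hmem := Nat.find_spec (exists_mem_words hgen s)
  obtain hn | ⟨n, hn⟩ : Nat.find (exists_mem_words hgen s) = 0 ∨
      ∃ n, Nat.find (exists_mem_words hgen s) = n + 1 :=
    (Nat.eq_zero_or_eq_succ_pred _).imp_right fun h => ⟨_, h⟩
  · rw [hn] at hmem
    exact absurd hmem hs
  · rw [hn] at hmem
    obtain ⟨t, ht, c, hc, rfl⟩ := hmem
    refine ⟨t, c, hc, rfl, ?_⟩
    change _ < Nat.find _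
    rw [hn]
    exact Nat.lt_succ_of_le (Nat.find_min' _ ht)

end Words

/-! ### The topological form -/

/-- In a countable locally compact Hausdorff space every point is the intersection of countably
many compact neighbourhoods, and these generate its neighbourhood filter. -/
theorem isCountablyGenerated_nhds {X : Type*} [TopologicalSpace X] [Countable X]
    [LocallyCompactSpace X] [T2Space X] (x : X) : (𝓝 x).IsCountablyGenerated := by
  have hK : ∀ y : X, ∃ K ∈ 𝓝 x, IsCompact K ∧ (y ∈ K → y = x) := fun y => by
    by_cases hy : y = x
    · obtain ⟨K, hK, hx⟩ := exists_compact_mem_nhds x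
      exact ⟨K, hx, hK, fun _ => hy⟩
    · obtain ⟨K, hx, hsub, hK⟩ :=
        local_compact_nhds (isOpen_compl_singleton.mem_nhds (Ne.symm hy : x ∈ ({y}ᶜ : Set X)))
      exact ⟨K, hx, hK, fun hyK => absurd rfl (hsub hyK)⟩
  choose K hx hK hy using hK
  have h : 𝓝 x = ⨅ y, 𝓟 (K y) := by
    refine le_antisymm (le_iInf fun y => le_principal_iff.mpr (hx y)) ?_
    refine le_iff_ultrafilter.mpr fun f hf => ?_
    have hf' : ∀ y, K y ∈ f := fun y => le_principal_iff.mp (hf.trans (iInf_le _ y))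
    obtain ⟨z, -, hz⟩ := (hK x).ultrafilter_le_nhds f (le_principal_iff.mpr (hf' x))
    have hzx : z = x := hy z ((hK z).isClosed.mem_of_tendsto hz (hf' z))
    exact hzx ▸ hz
  rw [h]
  infer_instance

/-- If a convergent sequence escapes every finite set, then along a subsequence a common last
generator can be split off so that the remaining prefixes are shorter, again converge, and again
escape every finite set. -/
theorem exists_tendsto_prefix {S : Type*} [Semigroup S] [IsCancelMul S] [TopologicalSpace S]
    [T2Space S] (hsemi : IsSemitopological S) (hrefl : TranslatesReflectConvergence S)
    {C : Set S} (hC : C.Finite) {ℓ : S → ℕ}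
    (hℓ : ∀ s ∉ C, ∃ t, ∃ c ∈ C, t * c = s ∧ ℓ t < ℓ s)
    {u : ℕ → S} {x : S} (hux : Tendsto u atTop (𝓝 x)) (hu : Tendsto u atTop cofinite) :
    ∃ (t : ℕ → S) (y v : S), Tendsto t atTop (𝓝 y) ∧ Tendsto t atTop cofinite ∧ y * v = x ∧
      ∀ n, ∃ m, t n * v = u m ∧ ℓ (t n) < ℓ (u m) := by
  have hev : ∀ᶠ n in atTop, ∃ c ∈ C, ∃ t, t * c = u n ∧ ℓ t < ℓ (u n) := by
    filter_upwards [hu.eventually hC.eventually_cofinite_notMem] with n hn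
    obtain ⟨t, c, hc, h⟩ := hℓ _ hn
    exact ⟨c, hc, t, h⟩
  obtain ⟨c, -, hfreq⟩ : ∃ c ∈ C, ∃ᶠ n in atTop, ∃ t, t * c = u n ∧ ℓ t < ℓ (u n) := by
    by_contra! hcon
    obtain ⟨n, ⟨c, hc, t, ht, hlt⟩, hn⟩ := (hev.and ((eventually_all_finite hC).mpr hcon)).exists
    exact (hn c hc t ht).not_gt hlt
  obtain ⟨φ, hφ, ht⟩ := extraction_of_frequently_atTop hfreq
  choose t ht hlt using ht
  have hfun : (fun n => t n * c) = u ∘ φ := funext ht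
  have hlim : Tendsto (fun n => t n * c) atTop (𝓝 x) := hfun ▸ hux.comp hφ.tendsto_atTop
  obtain ⟨y, hy⟩ := hrefl c t (Or.inl ⟨x, hlim⟩)
  refine ⟨t, y, c, hy, ?_, ?_, fun n => ⟨φ n, ht n, hlt n⟩⟩
  · refine Tendsto.of_tendsto_comp (g := (· * c)) (b := cofinite)
      (hfun ▸ hu.comp hφ.tendsto_atTop) ?_
    exact comap_cofinite_le _
  · exact tendsto_nhds_unique ((((hsemi c).2.tendsto y).comp hy)) hlim

/-- If `S` is not discrete, some sequence escaping every finite set converges. Splitting off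
generators from it forever gives infinitely many left divisors of its limit, unless two of these
coincide; then the word between them is a right identity by cancellation, although deleting it
strictly decreases the word length. -/
theorem discreteTopology_of_translatesReflectConvergence {S : Type*} [Semigroup S] [IsCancelMul S]
    [TopologicalSpace S] [LocallyCompactSpace S] [T2Space S] (hfg : FinitelyGenerated S)
    (hdiv : FinitelyLeftDivisible S) (hsemi : IsSemitopological S)
    (hrefl : TranslatesReflectConvergence S) : DiscreteTopology S := by
  have := hfg.countable
  obtain ⟨C, hC, hgen⟩ := hfg
  obtain ⟨ℓ, hℓ⟩ := exists_length hgen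
  rw [discreteTopology_iff_nhds_ne]
  intro x
  by_contra hne
  have : (𝓝[≠] x).NeBot := ⟨hne⟩
  have := isCountablyGenerated_nhds x
  have : (𝓝[≠] x).IsCountablyGenerated := by
    rw [nhdsWithin]
    infer_instance
  obtain ⟨u, hu⟩ := exists_seq_tendsto (𝓝[≠] x)
  let State := {p : (ℕ → S) × S // Tendsto p.1 atTop (𝓝 p.2) ∧ Tendsto p.1 atTop cofinite}
  -- The terms of `q` are shorter, and a fixed `v` on the right turns them into terms of `p`.
  let R : State → State → Prop := fun p q =>
    ∃ v, q.1.2 * v = p.1.2 ∧ ∀ n, ∃ m, q.1.1 n * v = p.1.1 m ∧ ℓ (q.1.1 n) < ℓ (p.1.1 m)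
  have hR : IsTrans State R := ⟨by
    rintro p q r ⟨v, hv, hv'⟩ ⟨w, hw, hw'⟩
    refine ⟨w * v, by rw [← mul_assoc, hw, hv], fun n => ?_⟩
    obtain ⟨m, hm, hlt⟩ := hw' n
    obtain ⟨k, hk, hlt'⟩ := hv' m
    exact ⟨k, by rw [← mul_assoc, hm, hk], hlt.trans hlt'⟩⟩
  have hstep : ∀ p : State, ∃ q, R p q := by
    rintro ⟨p, hp, hp'⟩
    obtain ⟨t, y, v, ht, ht', hyv, h⟩ := exists_tendsto_prefix hsemi hrefl hC hℓ hp hp'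
    exact ⟨⟨(t, y), ht, ht'⟩, v, hyv, h⟩
  choose next hnext using hstep
  let p₀ : State := ⟨(u, x), hu.mono_right nhdsWithin_le_nhds, hu.mono_right (nhdsNE_le_cofinite x)⟩
  let f : ℕ → State := fun n => Nat.rec p₀ (fun _ => next) n
  have hf : ∀ ⦃i j⦄, i < j → R (f i) (f j) := fun i j hij =>
    Nat.rel_of_forall_rel_succ_of_lt R (fun n => hnext (f n)) hij
  have hmaps : Set.MapsTo (fun i => (f i).1.2) (Set.Ioi 0) {t | ∃ r, t * r = x} := fun i hi => by
    obtain ⟨v, hv, -⟩ := hf hi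
    exact ⟨v, hv⟩
  obtain ⟨i, -, j, -, hij, heq⟩ :=
    (Set.Ioi_infinite 0).exists_lt_map_eq_of_mapsTo hmaps (hdiv x)
  obtain ⟨v, hv, hlen⟩ := hf hij
  obtain ⟨m, hm, hlt⟩ := hlen 0
  -- Cancelling the common limit makes `v` idempotent, hence a right identity of `S`.
  have hvv : v * v = v := by
    refine mul_left_cancel (a := (f j).1.2) ?_
    rw [← mul_assoc, hv, show (f i).1.2 = (f j).1.2 from heq, hv]
    exact heq
  have hid : (f j).1.1 0 * v = (f j).1.1 0 := by
    refine mul_right_cancel (b := v) ?_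
    rw [mul_assoc, hvv]
  rw [← hm, hid] at hlt
  exact lt_irrefl _ hlt

/-! ### The pairing with `ℓ¹(S)` -/

section Pairing

variable {S : Type*}

theorem hasSum_pairing (μ : EllInf S) (a : Ell1 S) : HasSum (fun s => a s * μ s) (pairing μ a) := by
  have ha : Summable fun s => ‖a s‖ := by
    simpa using (lp.memℓp a).summable (by norm_num)
  refine Summable.hasSum (Summable.of_norm_bounded (ha.mul_right ‖μ‖) fun s => ?_)
  rw [norm_mul]
  gcongr
  exact lp.norm_apply_le_norm ENNReal.top_ne_zero μ s

open Classical in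
theorem pairing_single (μ : EllInf S) (s : S) (c : ℂ) :
    pairing μ (lp.single 1 s c) = c * μ s := by
  rw [pairing, tsum_eq_single s]
  · rw [lp.single_apply_self]
  · intro t ht
    rw [lp.single_apply_ne _ _ _ ht, zero_mul]

open Classical in
theorem conv_single [Semigroup S] (s t : S) :
    conv (lp.single 1 s 1) (lp.single 1 t 1) = lp.single 1 (s * t) 1 := by
  ext u
  change ∑' p : {p : S × S // p.1 * p.2 = u}, _ = _
  by_cases hu : s * t = u
  · subst hu
    rw [tsum_eq_single ⟨(s, t), rfl⟩]
    · simp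
    · rintro ⟨⟨s', t'⟩, h⟩ hne
      by_cases hs : s' = s
      · have ht : t' ≠ t := by
          rintro rfl
          exact hne (by simp [hs])
        simp [Pi.single_apply, ht]
      · simp [Pi.single_apply, hs]
  · rw [lp.single_apply_ne _ _ _ (Ne.symm hu)]
    convert tsum_zero with p
    obtain ⟨⟨s', t'⟩, h⟩ := p
    by_cases hs : s' = s
    · have ht : t' ≠ t := by
        rintro rfl
        exact hu (by simpa [hs] using h)
      simp [Pi.single_apply, ht]
    · simp [Pi.single_apply, hs]

/-- The dual actions of point masses are translations. -/
theorem IsSubBimodule.exists_translate [Semigroup S] {E : Submodule ℂ (EllInf S)}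
    (hE : IsSubBimodule E) (r : S) {μ : EllInf S} (hμ : μ ∈ E) :
    (∃ ν ∈ E, ∀ t, ν t = μ (t * r)) ∧ (∃ ν ∈ E, ∀ t, ν t = μ (r * t)) := by
  classical
  obtain ⟨⟨ν, hν, h⟩, ⟨ν', hν', h'⟩⟩ := hE (lp.single 1 r 1) μ hμ
  refine ⟨⟨ν, hν, fun t => ?_⟩, ⟨ν', hν', fun t => ?_⟩⟩
  · simpa [conv_single, pairing_single] using h (lp.single 1 t 1)
  · simpa [conv_single, pairing_single] using h' (lp.single 1 t 1)

theorem IsBanachSpacePredual.eq_zero {E : Submodule ℂ (EllInf S)} (hE : IsBanachSpacePredual E)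
    {a : Ell1 S} (ha : ∀ μ ∈ E, pairing μ a = 0) : a = 0 := by
  obtain ⟨Φ, hΦ⟩ := hE
  refine (map_eq_zero_iff Φ Φ.injective).mp ?_
  ext μ
  rw [hΦ]
  exact ha μ μ.2

theorem IsBanachSpacePredual.exists_apply_ne_zero {E : Submodule ℂ (EllInf S)}
    (hE : IsBanachSpacePredual E) (s : S) : ∃ μ ∈ E, μ s ≠ 0 := by
  classical
  by_contra! h
  have h0 : lp.single 1 s (1 : ℂ) = (0 : Ell1 S) :=
    hE.eq_zero fun μ hμ => by rw [pairing_single, h μ hμ, mul_zero]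
  simpa using congrArg (fun a : Ell1 S => a s) h0

theorem IsBanachSpacePredual.eq_of_forall_apply_eq {E : Submodule ℂ (EllInf S)}
    (hE : IsBanachSpacePredual E) {s t : S} (hst : ∀ μ ∈ E, μ s = μ t) : s = t := by
  classical
  by_contra hne
  have h0 : lp.single 1 s (1 : ℂ) + lp.single 1 t (-1) = (0 : Ell1 S) := hE.eq_zero fun μ hμ => by
    have hadd := ((hasSum_pairing μ (lp.single 1 s 1)).add
      (hasSum_pairing μ (lp.single 1 t (-1)))).unique
        ((hasSum_pairing μ (lp.single 1 s 1 + lp.single 1 t (-1))).congr_fun ?_)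
    · rw [← hadd, pairing_single, pairing_single, hst μ hμ]
      ring
    · intro r
      simp [add_mul]
  have := congrArg (fun a : Ell1 S => a s) h0
  simp [hne] at this

end Pairing

/-! ### Limits of points in the dual of the predual -/

section Limits

variable {S : Type*} {E : Submodule ℂ (EllInf S)}

/-- Along an ultrafilter the point evaluations converge to a functional of norm at most one on `E`,
and this functional is given by an element of `ℓ¹(S)`. -/
theorem IsBanachSpacePredual.exists_tendsto (hE : IsBanachSpacePredual E) (F : Ultrafilter S) :
    ∃ a : Ell1 S, ∀ μ ∈ E, Tendsto (fun s => μ s) F (𝓝 (pairing μ a)) := by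
  have hlim : ∀ μ : EllInf S, ∃ z : ℂ, ‖z‖ ≤ ‖μ‖ ∧ Tendsto (fun s => μ s) F (𝓝 z) := fun μ => by
    have hmem : Metric.closedBall (0 : ℂ) ‖μ‖ ∈ F.map fun s => μ s :=
      Ultrafilter.mem_map.mpr <| univ_mem' fun s => by
        simpa using lp.norm_apply_le_norm ENNReal.top_ne_zero μ s
    obtain ⟨z, hz, h⟩ :=
      (isCompact_closedBall (0 : ℂ) ‖μ‖).ultrafilter_le_nhds _ (le_principal_iff.mpr hmem)
    exact ⟨z, by simpa using hz, h⟩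
  choose φ hφ hlim using hlim
  let φE : E →ₗ[ℂ] ℂ :=
    { toFun := fun μ => φ μ
      map_add' := fun μ ν => tendsto_nhds_unique (hlim _) (by
        simpa using (hlim (μ : EllInf S)).add (hlim (ν : EllInf S)))
      map_smul' := fun c μ => tendsto_nhds_unique (hlim _) (by
        simpa using (hlim (μ : EllInf S)).const_mul c) }
  obtain ⟨Φ, hΦ⟩ := hE
  refine ⟨Φ.symm (φE.mkContinuous 1 fun μ => by simpa [φE] using hφ μ), fun μ hμ => ?_⟩
  have := hΦ (Φ.symm (φE.mkContinuous 1 fun μ => by simpa [φE] using hφ μ)) ⟨μ, hμ⟩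
  rw [ContinuousLinearEquiv.apply_symm_apply] at this
  rw [← this]
  exact hlim μ

/-- An ultrafilter of points either converges to a point in the weak topology of `E`, or tends to
zero: its limit is a character of `E` of the form `a ∈ ℓ¹(S)`, and `⟨μν, a⟩ = ⟨μ, a⟩⟨ν, a⟩` for all
`μ` forces `a(s) ν(s) = ⟨ν, a⟩ a(s)`, so `⟨ν, a⟩ = ν(s)` wherever `a(s) ≠ 0`. -/
theorem tendsto_apply_or_tendsto_zero (hE : IsBanachSpacePredual E)
    (hmul : ∀ μ ∈ E, ∀ ν ∈ E, μ * ν ∈ E) (F : Ultrafilter S) :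
    (∃ s, ∀ μ ∈ E, Tendsto (fun t => μ t) F (𝓝 (μ s))) ∨
      ∀ μ ∈ E, Tendsto (fun t => μ t) F (𝓝 0) := by
  obtain ⟨a, ha⟩ := hE.exists_tendsto F
  have hpair : ∀ μ ∈ E, ∀ ν ∈ E, pairing (μ * ν) a = pairing μ a * pairing ν a :=
    fun μ hμ ν hν => tendsto_nhds_unique (ha _ (hmul μ hμ ν hν)) (by
      simpa [lp.infty_coeFn_mul] using (ha μ hμ).mul (ha ν hν))
  have key : ∀ ν ∈ E, ∀ s, a s * (ν s - pairing ν a) = 0 := fun ν hν => by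
    have hsum : Summable fun s => ‖a s‖ := by
      simpa using (lp.memℓp a).summable (by norm_num)
    have hmem : Memℓp (fun s => a s * (ν s - pairing ν a)) 1 := by
      refine memℓp_gen ?_
      simp only [ENNReal.toReal_one, Real.rpow_one]
      refine Summable.of_nonneg_of_le (fun _ => norm_nonneg _) (fun s => ?_)
        (hsum.mul_right (‖ν‖ + ‖pairing ν a‖))
      rw [norm_mul]
      gcongr
      refine (norm_sub_le _ _).trans ?_
      gcongr
      exact lp.norm_apply_le_norm ENNReal.top_ne_zero ν s
    let b : Ell1 S := ⟨_, hmem⟩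
    have hb : b = 0 := hE.eq_zero fun μ hμ => by
      have h1 := (hasSum_pairing (μ * ν) a).sub ((hasSum_pairing μ a).mul_right (pairing ν a))
      rw [hpair μ hμ ν hν, sub_self] at h1
      refine (hasSum_pairing μ b).unique (h1.congr_fun fun s => ?_)
      change a s * (ν s - pairing ν a) * μ s = _
      rw [lp.infty_coeFn_mul, Pi.mul_apply]
      ring
    exact fun s => congrArg (fun b : Ell1 S => b s) hb
  by_cases h : a = 0
  · right
    intro μ hμ
    simpa [h, pairing] using ha μ hμ
  · left
    obtain ⟨s, hs⟩ : ∃ s, a s ≠ 0 := by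
      by_contra! h0
      exact h (lp.ext (funext h0))
    refine ⟨s, fun μ hμ => ?_⟩
    rw [sub_eq_zero.mp ((mul_eq_zero.mp (key μ hμ s)).resolve_left hs)]
    exact ha μ hμ

end Limits

/-! ### The weak topology of a predual on the semigroup -/

section WeakTopology

variable {S : Type*} [TopologicalSpace S] {E : Submodule ℂ (EllInf S)}

theorem tendsto_nhds_iff_of_isInducing (hind : IsInducing fun (s : S) (μ : E) => (μ : EllInf S) s)
    {X : Type*} {l : Filter X} {f : X → S} {s : S} :
    Tendsto f l (𝓝 s) ↔ ∀ μ ∈ E, Tendsto (fun x => μ (f x)) l (𝓝 (μ s)) := by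
  rw [hind.tendsto_nhds_iff, tendsto_pi_nhds]
  simp

theorem continuous_apply_of_isInducing (hind : IsInducing fun (s : S) (μ : E) => (μ : EllInf S) s)
    {μ : EllInf S} (hμ : μ ∈ E) : Continuous fun s => μ s :=
  (continuous_apply (⟨μ, hμ⟩ : E)).comp hind.continuous

theorem t2Space_of_isInducing (hind : IsInducing fun (s : S) (μ : E) => (μ : EllInf S) s)
    (hE : IsBanachSpacePredual E) : T2Space S := by
  refine T2Space.of_injective_continuous (fun s t hst => ?_) hind.continuous
  exact hE.eq_of_forall_apply_eq fun μ hμ => congrFun hst ⟨μ, hμ⟩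

theorem isCompact_setOf_le_norm (hind : IsInducing fun (s : S) (μ : E) => (μ : EllInf S) s)
    (hE : IsBanachSpacePredual E) (hmul : ∀ μ ∈ E, ∀ ν ∈ E, μ * ν ∈ E)
    {μ : EllInf S} (hμ : μ ∈ E) {ε : ℝ} (hε : 0 < ε) : IsCompact {s | ε ≤ ‖μ s‖} := by
  have hclosed : IsClosed {s | ε ≤ ‖μ s‖} :=
    isClosed_le continuous_const (continuous_apply_of_isInducing hind hμ).norm
  refine isCompact_iff_ultrafilter_le_nhds.mpr fun F hF => ?_
  obtain ⟨s, hs⟩ | h0 := tendsto_apply_or_tendsto_zero hE hmul F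
  · have hlim : Tendsto id (F : Filter S) (𝓝 s) := (tendsto_nhds_iff_of_isInducing hind).mpr hs
    exact ⟨s, hclosed.mem_of_tendsto hlim (le_principal_iff.mp hF), hlim⟩
  · have hle : ε ≤ ‖(0 : ℂ)‖ := ge_of_tendsto (h0 μ hμ).norm (le_principal_iff.mp hF)
    rw [norm_zero] at hle
    exact absurd hle hε.not_ge

theorem locallyCompactSpace_of_isInducing
    (hind : IsInducing fun (s : S) (μ : E) => (μ : EllInf S) s)
    (hE : IsBanachSpacePredual E) (hmul : ∀ μ ∈ E, ∀ ν ∈ E, μ * ν ∈ E) :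
    LocallyCompactSpace S := by
  have := t2Space_of_isInducing hind hE
  have : WeaklyLocallyCompactSpace S := ⟨fun s => by
    obtain ⟨μ, hμ, hs⟩ := hE.exists_apply_ne_zero s
    have hpos : 0 < ‖μ s‖ := norm_pos_iff.mpr hs
    refine ⟨_, isCompact_setOf_le_norm hind hE hmul hμ (half_pos hpos), ?_⟩
    exact (continuous_apply_of_isInducing hind hμ).norm.continuousAt.eventually_const_le
      (half_lt_self hpos)⟩
  infer_instance

theorem continuous_of_comp_mem (hind : IsInducing fun (s : S) (μ : E) => (μ : EllInf S) s)
    {g : S → S} (hg : ∀ μ ∈ E, ∃ ν ∈ E, ∀ t, ν t = μ (g t)) : Continuous g := by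
  refine continuous_iff_continuousAt.mpr fun s => ?_
  refine (tendsto_nhds_iff_of_isInducing hind).mpr fun μ hμ => ?_
  obtain ⟨ν, hν, h⟩ := hg μ hμ
  simpa only [h] using (continuous_apply_of_isInducing hind hν).tendsto s

/-- If composition with an injective map `g` preserves `E`, then `g` reflects convergence: `g` fixes
the point at infinity, so a sequence whose image converges has no cluster point at infinity, and by
injectivity of `g` it has only one cluster point. -/
theorem converges_of_converges_comp (hind : IsInducing fun (s : S) (μ : E) => (μ : EllInf S) s)
    (hE : IsBanachSpacePredual E) (hmul : ∀ μ ∈ E, ∀ ν ∈ E, μ * ν ∈ E)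
    {g : S → S} (hinj : Function.Injective g) (hg : ∀ μ ∈ E, ∃ ν ∈ E, ∀ t, ν t = μ (g t))
    {u : ℕ → S} (hu : Converges fun n => g (u n)) : Converges u := by
  have := t2Space_of_isInducing hind hE
  obtain ⟨x, hx⟩ := hu
  have key : ∀ G : Ultrafilter ℕ, ↑G ≤ (atTop : Filter ℕ) →
      ∃ y, Tendsto u G (𝓝 y) ∧ g y = x := fun G hG => by
    obtain ⟨y, hy⟩ | h0 := tendsto_apply_or_tendsto_zero hE hmul (G.map u)
    · have hy' : Tendsto u G (𝓝 y) := (tendsto_nhds_iff_of_isInducing hind).mpr hy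
      exact ⟨y, hy', tendsto_nhds_unique
        (((continuous_of_comp_mem hind hg).tendsto y).comp hy') (hx.mono_left hG)⟩
    · obtain ⟨μ, hμ, hne⟩ := hE.exists_apply_ne_zero x
      obtain ⟨ν, hν, h⟩ := hg μ hμ
      have h1 : Tendsto (fun n => μ (g (u n))) G (𝓝 0) := by
        simpa only [h] using (show Tendsto (fun n => ν (u n)) G (𝓝 0) from h0 ν hν)
      have h2 := (tendsto_nhds_iff_of_isInducing hind).mp (hx.mono_left hG) μ hμ
      exact absurd (tendsto_nhds_unique h2 h1) hne
  obtain ⟨y, -, hy⟩ := key (Ultrafilter.of atTop) (Ultrafilter.of_le atTop)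
  refine ⟨y, (tendsto_iff_ultrafilter _ _ _).mpr fun G hG => ?_⟩
  obtain ⟨z, hz, hzx⟩ := key G hG
  exact hinj (hzx.trans hy.symm) ▸ hz

end WeakTopology

/-! ### Subspaces of `c₀` that separate `ℓ¹` -/

section c0

variable {S : Type*}

open Classical in
theorem hasSum_single_of_mem_c0 {μ : EllInf S} (hμ : μ ∈ c0 S) :
    HasSum (fun s => lp.single ∞ s (μ s) : S → EllInf S) μ := by
  refine Metric.tendsto_atTop.mpr fun ε hε => ?_
  have hfin : {s | ¬ ‖μ s‖ < ε / 2}.Finite :=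
    by
    simpa using Metric.tendsto_nhds.mp hμ (ε / 2) (half_pos hε)
  refine ⟨hfin.toFinset, fun F hF => ?_⟩
  rw [dist_comm, dist_eq_norm]
  refine (lp.norm_le_of_forall_le (half_pos hε).le fun s => ?_).trans_lt (half_lt_self hε)
  have hcoord : (μ - ∑ t ∈ F, lp.single ∞ t (μ t) : EllInf S) s = if s ∈ F then 0 else μ s := by
    rw [lp.coeFn_sub, lp.coeFn_sum, Pi.sub_apply, Finset.sum_apply]
    simp only [lp.single_apply, Pi.single_apply]
    split_ifs with h <;> simp [h]
  rw [hcoord]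
  split_ifs with h
  · simpa using (half_pos hε).le
  · by_contra hlt
    exact h (hF (by simpa using (not_le.mp hlt).le))

open Classical in
/-- The restriction to `c₀(S)` of a bounded functional is given by its values at the unit vectors,
which are absolutely summable. -/
theorem exists_pairing_eq (f : EllInf S →L[ℂ] ℂ) :
    ∃ a : Ell1 S, ∀ μ ∈ c0 S, f μ = pairing μ a := by
  let a : S → ℂ := fun s => f (lp.single ∞ s 1)
  have hsingle : ∀ s c, f (lp.single ∞ s c) = c * a s := fun s c => by
    have : (lp.single ∞ s c : EllInf S) = c • lp.single ∞ s 1 := by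
      rw [← lp.single_smul, smul_eq_mul, mul_one]
    rw [this, map_smul, smul_eq_mul]
  -- Test `f` against finitely supported vectors of modulus at most one with the phases of `a`.
  have hbound : ∀ F : Finset S, ∑ s ∈ F, ‖a s‖ ≤ ‖f‖ := fun F => by
    let c : S → ℂ := fun s => (‖a s‖ : ℂ) / a s
    have hc : ∀ s, c s * a s = ‖a s‖ := fun s => by
      by_cases h : a s = 0
      · simp [h]
      · exact div_mul_cancel₀ _ h
    let μ : EllInf S := ∑ s ∈ F, lp.single ∞ s (c s)
    have hμ : ‖μ‖ ≤ 1 := by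
      refine lp.norm_le_of_forall_le zero_le_one fun s => ?_
      have hcoord : μ s = if s ∈ F then c s else 0 := by
        change (∑ t ∈ F, lp.single ∞ t (c t) : EllInf S) s = _
        rw [lp.coeFn_sum, Finset.sum_apply]
        simp only [lp.single_apply, Pi.single_apply]
        split_ifs with h <;> simp [h]
      rw [hcoord]
      split_ifs
      · simpa [c] using div_self_le_one ‖a s‖
      · simp
    have hfμ : f μ = ((∑ s ∈ F, ‖a s‖ : ℝ) : ℂ) := by
      simp only [μ, map_sum, hsingle, hc]
      push_cast
      rfl
    calc ∑ s ∈ F, ‖a s‖ = ‖f μ‖ := by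
          rw [hfμ, Complex.norm_real, Real.norm_of_nonneg (by positivity)]
      _ ≤ ‖f‖ * ‖μ‖ := f.le_opNorm μ
      _ ≤ ‖f‖ := mul_le_of_le_one_right (norm_nonneg _) hμ
  have hmem : Memℓp a 1 := by
    refine memℓp_gen ?_
    simpa using summable_of_sum_le (fun s => norm_nonneg (a s)) hbound
  refine ⟨⟨a, hmem⟩, fun μ hμ => ?_⟩
  have h := (hasSum_single_of_mem_c0 hμ).mapL f
  simp only [hsingle, mul_comm _ (a _)] at h
  exact h.unique (hasSum_pairing μ ⟨a, hmem⟩)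

/-- Hahn–Banach: a closed subspace of `c₀(S)` that separates the points of `ℓ¹(S) = c₀(S)*` is all
of `c₀(S)`. -/
theorem IsBanachSpacePredual.eq_c0 {E : Submodule ℂ (EllInf S)} (hE : IsBanachSpacePredual E)
    (hclosed : IsClosed (E : Set (EllInf S))) (hle : E ≤ c0 S) : E = c0 S := by
  refine le_antisymm hle fun μ hμ => ?_
  by_contra hμE
  have hne : ‖(Submodule.Quotient.mk μ : EllInf S ⧸ E)‖ ≠ 0 := fun h0 => hμE (by
    have := (QuotientAddGroup.norm_mk_eq_zero_iff_mem_closure (S := E.toAddSubgroup)).mp h0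
    rwa [← SetLike.mem_coe, ← hclosed.closure_eq])
  obtain ⟨g, -, hg⟩ := exists_dual_vector ℂ _ hne
  let f : EllInf S →L[ℂ] ℂ := g.comp E.mkQL
  obtain ⟨a, ha⟩ := exists_pairing_eq f
  have ha0 : a = 0 := hE.eq_zero fun ν hν => by
    rw [← ha ν (hle hν)]
    change g (Submodule.Quotient.mk ν) = 0
    rw [(Submodule.Quotient.mk_eq_zero E).mpr hν, map_zero]
  have hf : f μ = 0 := by
    rw [ha μ hμ, ha0]
    simp [pairing]
  refine hne ?_
  have : ((‖(Submodule.Quotient.mk μ : EllInf S ⧸ E)‖ : ℝ) : ℂ) = 0 := hg.symm.trans hf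
  exact_mod_cast this

end c0

/-! ### Uniqueness of the Hopf algebra predual -/

theorem IsHopfAlgebraPredual.eq_c0 {S : Type*} [Semigroup S] [IsCancelMul S]
    (hfg : FinitelyGenerated S) (hdiv : FinitelyLeftDivisible S) {E : Submodule ℂ (EllInf S)}
    (hE : IsHopfAlgebraPredual E) : E = c0 S := by
  obtain ⟨hclosed, hbim, hpre, hmul⟩ := hE
  let _ : TopologicalSpace S :=
    TopologicalSpace.induced (fun (s : S) (μ : E) => (μ : EllInf S) s) inferInstance
  have hind : IsInducing fun (s : S) (μ : E) => (μ : EllInf S) s := ⟨rfl⟩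
  have hT2 := t2Space_of_isInducing hind hpre
  have hLC := locallyCompactSpace_of_isInducing hind hpre hmul
  have hleft (s : S) : ∀ μ ∈ E, ∃ ν ∈ E, ∀ t, ν t = μ (s * t) :=
    fun μ hμ => (hbim.exists_translate s hμ).2
  have hright (s : S) : ∀ μ ∈ E, ∃ ν ∈ E, ∀ t, ν t = μ (t * s) :=
    fun μ hμ => (hbim.exists_translate s hμ).1
  have hdisc : DiscreteTopology S := by
    refine discreteTopology_of_translatesReflectConvergence hfg hdiv
      (fun s => ⟨continuous_of_comp_mem hind (hleft s), continuous_of_comp_mem hind (hright s)⟩) ?_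
    rintro s u (hu | hu)
    · exact converges_of_converges_comp hind hpre hmul (mul_left_injective s) (hright s) hu
    · exact converges_of_converges_comp hind hpre hmul (mul_right_injective s) (hleft s) hu
  refine hpre.eq_c0 hclosed fun μ hμ => Metric.tendsto_nhds.mpr fun ε hε => ?_
  have hfin := (isCompact_setOf_le_norm hind hpre hmul hμ hε).finite_of_discrete
  exact hfin.subset fun s hs => by simpa using hs

end HopfPredual

theorem mainTheorem1 {S : Type*} [Semigroup S] [IsCancelMul S]
    (hfg : HopfPredual.FinitelyGenerated S) (hdiv : HopfPredual.FinitelyLeftDivisible S) :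
    (∀ E : Submodule ℂ (HopfPredual.EllInf S),
      HopfPredual.IsHopfAlgebraPredual E → E = HopfPredual.c0 S) ∧
    (∀ σ : TopologicalSpace S, LocallyCompactSpace S → T2Space S →
      HopfPredual.IsSemitopological S → HopfPredual.TranslatesReflectConvergence S →
      DiscreteTopology S) :=
  ⟨fun _ hE => hE.eq_c0 hfg hdiv, fun _ _ _ hsemi hrefl =>
    HopfPredual.discreteTopology_of_translatesReflectConvergence hfg hdiv hsemi hrefl⟩
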